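/- Let $\mathbb{D}=\{z\in\mathbb{C}:|z|<1\}$, and let $w:\mathbb{D}\to(0,\infty]$ be a positive superharmonic function, that is, $w$ is lower semicontinuous and for every $z\in\mathbb{D}$ there is $\rho>0$ such that $\{|\zeta-z|<\rho\}\subset\mathbb{D}$ and \[ \frac1{2\pi}\int_0^{2\pi}w(z+re^{i\theta})\,d\theta\le w(z)\qquad(0<r<\rho). \] Let $\mathcal{D}_w$ be the set of all holomorphic functions $f:\mathbb{D}\to\mathbb{C}$ such that \[ \mathcal{D}_w(f):=\frac1\pi\int_{\mathbb{D}}|f'(z)|^2\,w(z)\,dA(z)<\infty, \] where $dA$ is the area measure. Then $\mathcal{D}_w$ contains a function $f$ with $f(\mathbb{D})=\mathbb{C}$ if and only if $\inf_{z\in\mathbb{D}}w(z)=0$. -/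

import Mathlib

open MeasureTheory
open scoped ENNReal

/-- The open unit disk in `ℂ`. -/
def unitDisk : Set ℂ := Metric.ball (0 : ℂ) 1

/-- The mean of a `[0, ∞]`-valued function over the circle with center `z` and radius `r`. -/
noncomputable def circleMean (w : ℂ → ℝ≥0∞) (z : ℂ) (r : ℝ) : ℝ≥0∞ :=
  (ENNReal.ofReal (2 * Real.pi))⁻¹ *
    ∫⁻ θ in Set.Ioc (0 : ℝ) (2 * Real.pi), w (circleMap z r θ)

/-- Positive superharmonic functions on a set `U` (meant to be open), as functions with values in
`(0, ∞]`: lower semicontinuous on `U`, and satisfying the local super-mean-value inequality at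
every point of `U`. Only the values of `w` on `U` matter. The constant `∞` is not excluded. -/
structure IsPositiveSuperharmonicOn (w : ℂ → ℝ≥0∞) (U : Set ℂ) : Prop where
  pos : ∀ z ∈ U, 0 < w z
  lowerSemicontinuousOn : LowerSemicontinuousOn w U
  circleMean_le : ∀ z ∈ U, ∃ ρ : ℝ, 0 < ρ ∧ Metric.ball z ρ ⊆ U ∧
    ∀ r : ℝ, 0 < r → r < ρ → circleMean w z r ≤ w z

/-- The weighted Dirichlet integral `(1/π) ∫_𝔻 |f'|² w dA`, with values in `[0, ∞]`. -/
noncomputable def dirichletIntegral (w : ℂ → ℝ≥0∞) (f : ℂ → ℂ) : ℝ≥0∞ :=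
  (ENNReal.ofReal Real.pi)⁻¹ * ∫⁻ z in unitDisk, ‖deriv f z‖ₑ ^ 2 * w z

/-- The weighted Dirichlet space `𝒟_w`: functions that are holomorphic on the unit disk and have
finite weighted Dirichlet integral. (The values outside the disk are irrelevant.) -/
def dirichletSpace (w : ℂ → ℝ≥0∞) : Set (ℂ → ℂ) :=
  {f | DifferentiableOn ℂ f unitDisk ∧ dirichletIntegral w f < ∞}

/-! If `w` is bounded below by `c > 0`, then `c` times the area of the image is at most the weighted
integral of `|f'|²`, so the image has finite area and is not the plane.

Conversely, let `φ` be the disk involution exchanging `0` and `a`. The key estimate is that the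
integral of `|φ'|² w` is at most `π w(a)` (`setLIntegral_deriv_diskInvolution_le`): a change of
variables turns it into the integral of `w ∘ φ`, which is bounded by super-mean value inequalities
on circles about `0`. The hypothesis only gives small circles about each point; `re_le_of_boundary`
compares `w` with real parts of holomorphic functions and removes this restriction.

Hence the bump `R φ (φ - a)` costs at most `9 π R² w(a)`, however large `R` is, once `w(a)` is small
enough. Its factor `φ - a` makes it small on compact sets when `a` is near the circle; its factor
`φ` makes it vanish at `a`, so that its values near `a` surround `0`. Since `w` has a positive
minimum on compact sets, `inf w = 0` supplies such points `a k` tending rapidly to the circle. In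
the sum of bumps with heights growing geometrically, the `k`-th term dominates near `a k`, and a
quantitative open mapping theorem shows that every value of modulus at most `k` is taken there. -/

open Set Metric Filter Topology

/-! ### Approximation and mean value tools -/

/-- A lower semicontinuous `[0, ∞]`-valued function is an increasing limit of bounded continuous
functions. -/
theorem LowerSemicontinuous.exists_monotone_continuous_iSup_eq {X : Type*} [PseudoEMetricSpace X]
    {f : X → ℝ≥0∞} (hf : LowerSemicontinuous f) :
    ∃ g : ℕ → X → ℝ≥0∞, (∀ n, Continuous (g n)) ∧ Monotone g ∧ (∀ n x, g n x ≤ n) ∧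
      ∀ x, ⨆ n, g n x = f x := by
  have hle : ∀ (n : ℕ) x, ⨅ y, (f y ⊓ n + n * edist x y) ≤ f x ⊓ n := fun n x =>
    (iInf_le _ x).trans (by simp)
  -- Inf-convolution of the truncation `f ⊓ n` with `n * edist`, which is `n`-Lipschitz.
  refine ⟨fun n x => ⨅ y, (f y ⊓ n + n * edist x y), fun n => ?_, fun m n hmn x => ?_,
    fun n x => (hle n x).trans inf_le_right, fun x => le_antisymm ?_ ?_⟩
  · refine continuous_of_le_add_edist n (ENNReal.natCast_ne_top n) fun x y => ?_
    rw [ENNReal.iInf_add]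
    refine iInf_mono fun a => ?_
    rw [add_assoc, ← mul_add]
    gcongr
    rw [add_comm]
    exact edist_triangle x y a
  · dsimp only
    gcongr
  · exact iSup_le fun n => (hle n x).trans inf_le_left
  · refine le_of_forall_lt fun c hc => ?_
    obtain ⟨d, hcd, hd⟩ := exists_between hc
    obtain ⟨δ, hδ, hδt, hball⟩ : ∃ δ : ℝ≥0∞, 0 < δ ∧ δ ≠ ∞ ∧ ∀ y, edist y x < δ → d < f y := by
      obtain ⟨δ, hδ, hball⟩ := EMetric.mem_nhds_iff.1 (hf x d hd)
      exact ⟨min δ 1, lt_min hδ one_pos, by simp, fun y hy => hball (hy.trans_le (min_le_left _ _))⟩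
    have hdt : d ≠ ∞ := hd.ne_top
    obtain ⟨n, hn⟩ := ENNReal.exists_nat_gt
      (ENNReal.add_ne_top.2 ⟨hdt, ENNReal.div_ne_top hdt hδ.ne'⟩)
    refine hcd.trans_le (le_iSup_of_le n (le_iInf fun y => ?_))
    by_cases hy : edist y x < δ
    · exact le_add_right (le_inf (hball y hy).le (le_self_add.trans hn.le))
    · rw [not_lt, edist_comm] at hy
      refine le_add_left ?_
      calc d ≤ (d / δ) * edist x y := by
            calc d = d / δ * δ := (ENNReal.div_mul_cancel hδ.ne' hδt).symm
              _ ≤ _ := by gcongr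
        _ ≤ n * edist x y := by gcongr; exact le_add_self.trans hn.le

/-- On a circle centered at the origin, continuous real functions can be uniformly approximated by
real parts of entire functions. -/
theorem exists_differentiable_re_approx_on_sphere {g : ℂ → ℝ} (hg : Continuous g) {r ε : ℝ}
    (hr : 0 < r) (hε : 0 < ε) :
    ∃ G : ℂ → ℂ, Differentiable ℂ G ∧ ∀ θ : ℝ,
      |g (circleMap 0 r θ) - (G (circleMap 0 r θ)).re| < ε := by
  have : Fact (0 < 2 * Real.pi) := ⟨Real.two_pi_pos⟩
  let P : C(AddCircle (2 * Real.pi), ℂ) → Prop := fun F => ∃ G₁ G₂ : ℂ → ℂ,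
    Differentiable ℂ G₁ ∧ Differentiable ℂ G₂ ∧ ∀ θ : ℝ,
      F (θ : AddCircle (2 * Real.pi)) =
        G₁ (circleMap 0 r θ) + (starRingEnd ℂ) (G₂ (circleMap 0 r θ))
  have hspan : ∀ F ∈ Submodule.span ℂ (range (@fourier (2 * Real.pi))), P F := by
    intro F hF
    induction hF using Submodule.span_induction with
    | mem F hF =>
      obtain ⟨n, rfl⟩ := hF
      have key : ∀ θ : ℝ, fourier n (θ : AddCircle (2 * Real.pi)) =
          (circleMap 0 r θ / r) ^ n := by
        intro θ
        have hr' : (r : ℂ) ≠ 0 := by exact_mod_cast hr.ne'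
        rw [fourier_coe_apply, circleMap_zero, mul_div_cancel_left₀ _ hr', ← Complex.exp_int_mul]
        congr 1
        push_cast
        field_simp [Real.pi_ne_zero]
      rcases n with n | n
      · refine ⟨fun z => (z / r) ^ n, 0, by fun_prop, differentiable_const 0, fun θ => ?_⟩
        rw [key]
        simp
      · refine ⟨0, fun z => (z / r) ^ (n + 1), differentiable_const 0, by fun_prop, fun θ => ?_⟩
        -- On the unit circle the inverse is the conjugate, so negative frequencies are conjugates
        -- of polynomials.
        have hu : ‖circleMap 0 r θ / r‖ = 1 := by simp [abs_of_pos hr, hr.ne']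
        rw [key, zpow_negSucc, Complex.inv_def, Complex.normSq_eq_norm_sq, norm_pow, hu]
        simp
    | zero => exact ⟨0, 0, differentiable_const 0, differentiable_const 0, by simp⟩
    | add F₁ F₂ _ _ h₁ h₂ =>
      obtain ⟨G₁, G₂, d₁, d₂, e⟩ := h₁
      obtain ⟨G₁', G₂', d₁', d₂', e'⟩ := h₂
      refine ⟨G₁ + G₁', G₂ + G₂', d₁.add d₁', d₂.add d₂', fun θ => ?_⟩
      simp only [ContinuousMap.add_apply, e, e', Pi.add_apply, map_add]
      ring
    | smul c F _ h =>
      obtain ⟨G₁, G₂, d₁, d₂, e⟩ := h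
      refine ⟨fun z => c * G₁ z, fun z => (starRingEnd ℂ) c * G₂ z, d₁.const_mul _,
        d₂.const_mul _, fun θ => ?_⟩
      simp only [ContinuousMap.smul_apply, e, smul_eq_mul, map_mul, Complex.conj_conj]
      ring
  have hper : Function.Periodic (fun θ : ℝ => (g (circleMap 0 r θ) : ℂ)) (2 * Real.pi) := fun θ => by
    simp only [periodic_circleMap 0 r θ]
  let γ : C(AddCircle (2 * Real.pi), ℂ) := ⟨hper.lift, by
    refine continuous_coinduced_dom.2 ?_
    exact Complex.continuous_ofReal.comp (hg.comp (continuous_circleMap 0 r))⟩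
  have hγ : γ ∈ closure (Submodule.span ℂ (range (@fourier (2 * Real.pi))) : Set _) := by
    have := congrArg (fun S : Submodule ℂ C(AddCircle (2 * Real.pi), ℂ) => γ ∈ S)
      (span_fourier_closure_eq_top (T := 2 * Real.pi))
    simpa [← SetLike.mem_coe] using this
  obtain ⟨F, hF, hFγ⟩ := Metric.mem_closure_iff.1 hγ ε hε
  obtain ⟨G₁, G₂, d₁, d₂, e⟩ := hspan F hF
  -- Conjugating `G₂` does not change the real part.
  refine ⟨G₁ + G₂, d₁.add d₂, fun θ => ?_⟩
  have h1 := (ContinuousMap.dist_apply_le_dist (f := γ) (g := F)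
    (θ : AddCircle (2 * Real.pi))).trans_lt hFγ
  have h2 : γ (θ : AddCircle (2 * Real.pi)) = (g (circleMap 0 r θ) : ℂ) := rfl
  rw [h2, e, dist_eq_norm] at h1
  refine lt_of_le_of_lt ?_ h1
  refine le_trans (le_of_eq ?_) (Complex.abs_re_le_norm _)
  simp

/-- Mean value property for the real part of a holomorphic function. -/
theorem integral_re_circleMap {G : ℂ → ℂ} {c : ℂ} {s : ℝ} (hs : 0 < s)
    (hG : DifferentiableOn ℂ G (closedBall c s)) :
    ∫ θ in Ioc 0 (2 * Real.pi), (G (circleMap c s θ)).re = 2 * Real.pi * (G c).re := by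
  have h1 : Real.circleAverage G c s = G c := DiffContOnCl.circleAverage (by
    rw [abs_of_pos hs]
    exact (hG.mono (closure_ball c hs.ne').subset).diffContOnCl)
  have hcont : Continuous fun θ => G (circleMap c s θ) :=
    hG.continuousOn.comp_continuous (continuous_circleMap c s) fun θ =>
      circleMap_mem_closedBall c hs.le θ
  rw [Real.circleAverage_def, inv_smul_eq_iff₀ Real.two_pi_pos.ne'] at h1
  rw [← intervalIntegral.integral_of_le Real.two_pi_pos.le]
  have h2 := Complex.reCLM.intervalIntegral_comp_comm
    (hcont.intervalIntegrable (μ := volume) 0 (2 * Real.pi))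
  rw [h1] at h2
  simpa using h2

theorem ofReal_integral_le_lintegral_ofReal {α : Type*} [MeasurableSpace α] {μ : Measure α}
    (f : α → ℝ) : ENNReal.ofReal (∫ x, f x ∂μ) ≤ ∫⁻ x, ENNReal.ofReal (f x) ∂μ := by
  by_cases hf : Integrable f μ
  · rw [integral_eq_lintegral_pos_part_sub_lintegral_neg_part hf]
    exact (ENNReal.ofReal_le_ofReal (sub_le_self _ ENNReal.toReal_nonneg)).trans
      ENNReal.ofReal_toReal_le
  · simp [integral_undef hf]

/-! ### The minimum principle -/

/-- Minimum principle for `w - Re G`. -/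
theorem IsPositiveSuperharmonicOn.re_le_of_boundary {w : ℂ → ℝ≥0∞}
    (hw : IsPositiveSuperharmonicOn w unitDisk) {K O : Set ℂ} (hK : IsCompact K)
    (hKD : K ⊆ unitDisk) (hO : IsOpen O) (hOK : O ⊆ K) {G : ℂ → ℂ}
    (hG : DifferentiableOn ℂ G unitDisk)
    (hb : ∀ x ∈ K \ O, ENNReal.ofReal (G x).re ≤ w x) :
    ∀ x ∈ K, ENNReal.ofReal (G x).re ≤ w x := by
  by_contra! hcon
  obtain ⟨x₁, hx₁K, hx₁⟩ := hcon
  have hqc : ContinuousOn (fun x => (G x).re) K :=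
    Complex.continuous_re.comp_continuousOn (hG.continuousOn.mono hKD)
  obtain ⟨N, hN⟩ : ∃ N : ℝ, ∀ x ∈ K, (G x).re < N := by
    obtain ⟨M, hM⟩ := (hK.image_of_continuousOn hqc).bddAbove
    exact ⟨M + 1, fun x hx => (hM (mem_image_of_mem _ hx)).trans_lt (lt_add_one M)⟩
  -- Truncating at `N > Re G` gives a real-valued function, so differences make sense; the
  -- truncation turns out to be inactive at the minimum point `x₀`.
  set u : ℂ → ℝ := fun x => (w x ⊓ ENNReal.ofReal N).toReal with hu
  have hu_le : ∀ x, ENNReal.ofReal (u x) ≤ w x := fun x =>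
    ENNReal.ofReal_toReal_le.trans inf_le_left
  have hulsc : LowerSemicontinuousOn u K := by
    have hc : Continuous fun t : ℝ≥0∞ => (t ⊓ ENNReal.ofReal N).toReal := by
      rw [← continuousOn_univ]
      exact ENNReal.continuousOn_toReal.comp (by fun_prop) fun t _ =>
        (inf_le_right.trans_lt ENNReal.ofReal_lt_top).ne
    refine hc.comp_lowerSemicontinuousOn (hw.lowerSemicontinuousOn.mono hKD) fun a b hab => ?_
    exact ENNReal.toReal_mono (inf_le_right.trans_lt ENNReal.ofReal_lt_top).ne
      (inf_le_inf_right _ hab)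
  set ε : ℝ := (G x₁).re - u x₁ with hε
  have hu1 : u x₁ < (G x₁).re := by
    have hpos : 0 < (G x₁).re := by
      by_contra! h
      simp [ENNReal.ofReal_of_nonpos h] at hx₁
    have := ENNReal.toReal_strict_mono ENNReal.ofReal_ne_top hx₁
    rw [ENNReal.toReal_ofReal hpos.le] at this
    exact (ENNReal.toReal_mono hx₁.ne_top inf_le_left).trans_lt this
  have hε0 : 0 < ε := sub_pos.2 hu1
  -- The term `ε‖x‖²` raises circle means strictly, so an interior minimum of `u - q` is
  -- contradictory at once. It stays below the gap `ε` on the disk, which keeps the minimum off `K \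
  -- O`.
  set q : ℂ → ℝ := fun x => (G x).re + ε * ‖x‖ ^ 2 with hq
  have hqc' : ContinuousOn q K := hqc.add (by fun_prop)
  have hlsc : LowerSemicontinuousOn (fun x => u x + -q x) K :=
    hulsc.add hqc'.neg.lowerSemicontinuousOn
  obtain ⟨x₀, hx₀K, hmin⟩ := hlsc.exists_isMinOn ⟨x₁, hx₁K⟩ hK
  have hmin' : ∀ x ∈ K, u x₀ - q x₀ ≤ u x - q x := fun x hx => by
    simpa [sub_eq_add_neg] using hmin hx
  have hm1 : u x₀ - q x₀ ≤ -ε := by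
    refine (hmin' x₁ hx₁K).trans ?_
    have : 0 ≤ ε * ‖x₁‖ ^ 2 := by positivity
    simp only [hq]
    linarith
  have hnorm : ∀ x ∈ K, ε * ‖x‖ ^ 2 < ε := fun x hx => by
    have h1 : ‖x‖ < 1 := by simpa [unitDisk] using hKD hx
    have : ‖x‖ ^ 2 < 1 := pow_lt_one₀ (norm_nonneg _) h1 two_ne_zero
    nlinarith
  have hx₀O : x₀ ∈ O := by
    by_contra hxO
    have h1 := hb x₀ ⟨hx₀K, hxO⟩
    have h2 : (G x₀).re ≤ u x₀ := by
      have : ENNReal.ofReal (G x₀).re ≤ w x₀ ⊓ ENNReal.ofReal N :=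
        le_inf h1 (ENNReal.ofReal_le_ofReal (hN x₀ hx₀K).le)
      exact (ENNReal.ofReal_le_iff_le_toReal
        (inf_le_right.trans_lt ENNReal.ofReal_lt_top).ne).1 this
    have h3 := hnorm x₀ hx₀K
    simp only [hq] at hm1
    linarith
  have hw0 : w x₀ = ENNReal.ofReal (u x₀) := by
    have h1 : u x₀ < N := by
      have h3 := hnorm x₀ hx₀K
      have h4 := hN x₀ hx₀K
      simp only [hq] at hm1
      linarith
    rcases le_total (w x₀) (ENNReal.ofReal N) with h | h
    · rw [hu]
      simp only [inf_eq_left.2 h]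
      rw [ENNReal.ofReal_toReal (h.trans_lt ENNReal.ofReal_lt_top).ne]
    · exfalso
      have : u x₀ = max N 0 := by simp [hu, inf_eq_right.2 h, ENNReal.toReal_ofReal']
      exact absurd h1 (not_lt.2 (this ▸ le_max_left _ _))
  obtain ⟨ρ, hρ, hρD, hmean⟩ := hw.circleMean_le x₀ (hKD hx₀K)
  obtain ⟨σ, hσ, hσO⟩ := Metric.isOpen_iff.1 hO x₀ hx₀O
  set s : ℝ := min ρ σ / 2 with hs
  have hs0 : 0 < s := by positivity
  have hsρ : s < ρ := (half_lt_self (lt_min hρ hσ)).trans_le (min_le_left _ _)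
  have hsσ : s < σ := (half_lt_self (lt_min hρ hσ)).trans_le (min_le_right _ _)
  have hmem : ∀ θ, circleMap x₀ s θ ∈ K := fun θ => hOK (hσO (by
    simp [circleMap, abs_of_pos hs0, hsσ]))
  set Q : ℂ → ℝ := fun x => q x + (u x₀ - q x₀) with hQ
  have hQw : ∀ θ, ENNReal.ofReal (Q (circleMap x₀ s θ)) ≤ w (circleMap x₀ s θ) := fun θ =>
    (ENNReal.ofReal_le_ofReal (by have := hmin' _ (hmem θ); simp only [hQ]; linarith)).trans
      (hu_le _)
  have hInt : ∫ θ in Ioc 0 (2 * Real.pi), Q (circleMap x₀ s θ) =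
      2 * Real.pi * (u x₀ + ε * s ^ 2) := by
    have hball : closedBall x₀ s ⊆ unitDisk := (closedBall_subset_ball hsρ).trans hρD
    -- On this circle `‖x‖²` is the real part of an affine function of `x`, so `Q` agrees there with
    -- the real part of a holomorphic function.
    have hH : DifferentiableOn ℂ (fun x => G x + (ε * ((‖x₀‖ ^ 2 + s ^ 2 : ℝ) +
        (2 : ℝ) * ((starRingEnd ℂ) x₀ * (x - x₀))) + (u x₀ - q x₀ : ℝ))) (closedBall x₀ s) :=
      (hG.mono hball).add (by fun_prop)
    convert integral_re_circleMap hs0 hH using 3 with θ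
    · have h1 : ‖circleMap x₀ s θ‖ ^ 2 =
          ‖x₀‖ ^ 2 + s ^ 2 + 2 * ((starRingEnd ℂ) x₀ * (circleMap x₀ s θ - x₀)).re := by
        have h2 : ‖circleMap x₀ s θ - x₀‖ ^ 2 = s ^ 2 := by simp [circleMap]
        rw [← h2]
        simp only [← Complex.normSq_eq_norm_sq, Complex.normSq_apply, Complex.mul_re,
          Complex.sub_re, Complex.sub_im, Complex.conj_re, Complex.conj_im]
        ring
      simp only [hQ, hq, h1, Complex.add_re, Complex.re_ofReal_mul, Complex.ofReal_re]
      ring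
    · simp only [hq, Complex.add_re, Complex.re_ofReal_mul, Complex.ofReal_re, sub_self, mul_zero,
        Complex.zero_re]
      ring
  have hπ : (0 : ℝ) < 2 * Real.pi := Real.two_pi_pos
  have hfin : ENNReal.ofReal (u x₀ + ε * s ^ 2) ≤ ENNReal.ofReal (u x₀) := by
    calc ENNReal.ofReal (u x₀ + ε * s ^ 2)
        = (ENNReal.ofReal (2 * Real.pi))⁻¹ *
            ENNReal.ofReal (2 * Real.pi * (u x₀ + ε * s ^ 2)) := by
          rw [ENNReal.ofReal_mul hπ.le, ← mul_assoc, ENNReal.inv_mul_cancel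
            (ENNReal.ofReal_pos.2 hπ).ne' ENNReal.ofReal_ne_top, one_mul]
      _ ≤ circleMean w x₀ s := by
          unfold circleMean
          gcongr
          rw [← hInt]
          exact (ofReal_integral_le_lintegral_ofReal _).trans (lintegral_mono hQw)
      _ ≤ w x₀ := hmean s hs0 hsρ
      _ = ENNReal.ofReal (u x₀) := hw0
  rw [ENNReal.ofReal_le_ofReal_iff ENNReal.toReal_nonneg] at hfin
  have : 0 < ε * s ^ 2 := by positivity
  linarith

/-! ### Disk involutions -/

/-- The holomorphic involution of the unit disk that exchanges `0` and `a`. -/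
noncomputable def diskInvolution (a z : ℂ) : ℂ := (a - z) / (1 - (starRingEnd ℂ) a * z)

section diskInvolution

variable {a z : ℂ}

theorem mem_unitDisk : z ∈ unitDisk ↔ ‖z‖ < 1 := by simp [unitDisk]

theorem isOpen_unitDisk : IsOpen unitDisk := isOpen_ball

theorem one_sub_norm_le_norm_one_sub_conj_mul (ha : ‖a‖ ≤ 1) :
    1 - ‖z‖ ≤ ‖1 - (starRingEnd ℂ) a * z‖ := by
  have h1 : ‖(starRingEnd ℂ) a * z‖ ≤ ‖z‖ := by
    rw [norm_mul, RCLike.norm_conj]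
    exact mul_le_of_le_one_left (norm_nonneg _) ha
  have h2 := norm_sub_norm_le (1 : ℂ) ((starRingEnd ℂ) a * z)
  rw [norm_one] at h2
  linarith

theorem one_sub_conj_mul_ne_zero (ha : ‖a‖ < 1) (hz : ‖z‖ < 1) :
    1 - (starRingEnd ℂ) a * z ≠ 0 := by
  have := one_sub_norm_le_norm_one_sub_conj_mul (z := z) ha.le
  exact norm_pos_iff.1 (by linarith)

theorem one_sub_norm_diskInvolution_sq (ha : ‖a‖ < 1) (hz : ‖z‖ < 1) :
    1 - ‖diskInvolution a z‖ ^ 2 =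
      (1 - ‖a‖ ^ 2) * (1 - ‖z‖ ^ 2) / ‖1 - (starRingEnd ℂ) a * z‖ ^ 2 := by
  have h := one_sub_conj_mul_ne_zero ha hz
  have h' : ‖1 - (starRingEnd ℂ) a * z‖ ^ 2 ≠ 0 := by positivity
  rw [diskInvolution, norm_div, div_pow, eq_div_iff h', sub_mul, div_mul_cancel₀ _ h']
  simp only [← Complex.normSq_eq_norm_sq, Complex.normSq_apply, Complex.mul_re, Complex.mul_im,
    Complex.sub_re, Complex.sub_im, Complex.conj_re, Complex.conj_im, Complex.one_re,
    Complex.one_im]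
  ring

theorem norm_diskInvolution_lt_one (ha : ‖a‖ < 1) (hz : ‖z‖ < 1) : ‖diskInvolution a z‖ < 1 := by
  have h := one_sub_conj_mul_ne_zero ha hz
  have h1 : 0 < 1 - ‖a‖ ^ 2 := by nlinarith [norm_nonneg a]
  have h2 : 0 < 1 - ‖z‖ ^ 2 := by nlinarith [norm_nonneg z]
  have h3 : 0 < 1 - ‖diskInvolution a z‖ ^ 2 := by
    rw [one_sub_norm_diskInvolution_sq ha hz]
    positivity
  nlinarith [norm_nonneg (diskInvolution a z)]

theorem diskInvolution_diskInvolution (ha : ‖a‖ < 1) (hz : ‖z‖ < 1) :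
    diskInvolution a (diskInvolution a z) = z := by
  have h := one_sub_conj_mul_ne_zero ha hz
  have h' := one_sub_conj_mul_ne_zero ha (norm_diskInvolution_lt_one ha hz)
  have h2 : diskInvolution a z * (1 - (starRingEnd ℂ) a * z) = a - z := div_mul_cancel₀ _ h
  rw [diskInvolution, div_eq_iff h']
  refine mul_right_cancel₀ h ?_
  linear_combination ((starRingEnd ℂ) a * z - 1) * h2

@[simp]
theorem diskInvolution_zero : diskInvolution a 0 = a := by simp [diskInvolution]

@[simp]
theorem diskInvolution_self : diskInvolution a a = 0 := by simp [diskInvolution]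

theorem diskInvolution_sub (ha : ‖a‖ < 1) (hz : ‖z‖ < 1) :
    diskInvolution a z - a = -(z * (1 - ‖a‖ ^ 2 : ℝ)) / (1 - (starRingEnd ℂ) a * z) := by
  have h := one_sub_conj_mul_ne_zero ha hz
  have h2 : ((1 - ‖a‖ ^ 2 : ℝ) : ℂ) = 1 - (starRingEnd ℂ) a * a := by
    rw [Complex.conj_mul']
    push_cast
    rfl
  rw [h2, diskInvolution, eq_div_iff h, sub_mul, div_mul_cancel₀ _ h]
  ring

theorem differentiableOn_diskInvolution (ha : ‖a‖ < 1) :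
    DifferentiableOn ℂ (diskInvolution a) unitDisk := by
  unfold diskInvolution
  exact DifferentiableOn.div (by fun_prop) (by fun_prop) fun z hz =>
    one_sub_conj_mul_ne_zero ha (mem_unitDisk.1 hz)

theorem mapsTo_diskInvolution (ha : ‖a‖ < 1) : MapsTo (diskInvolution a) unitDisk unitDisk :=
  fun _ hz => mem_unitDisk.2 (norm_diskInvolution_lt_one ha (mem_unitDisk.1 hz))

theorem injOn_diskInvolution (ha : ‖a‖ < 1) : InjOn (diskInvolution a) unitDisk :=
  LeftInvOn.injOn (f₁' := diskInvolution a) fun _ hz =>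
    diskInvolution_diskInvolution ha (mem_unitDisk.1 hz)

theorem image_diskInvolution_unitDisk (ha : ‖a‖ < 1) : diskInvolution a '' unitDisk = unitDisk :=
  (mapsTo_diskInvolution ha).image_subset.antisymm fun _ hz =>
    ⟨_, mapsTo_diskInvolution ha hz, diskInvolution_diskInvolution ha (mem_unitDisk.1 hz)⟩

end diskInvolution

/-! ### Superharmonic weights and disk involutions -/

theorem LowerSemicontinuousOn.lowerSemicontinuous_indicator {X : Type*} [TopologicalSpace X]
    {f : X → ℝ≥0∞} {U : Set X} (hf : LowerSemicontinuousOn f U) (hU : IsOpen U) :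
    LowerSemicontinuous (U.indicator f) := by
  intro x y hy
  by_cases hx : x ∈ U
  · rw [indicator_of_mem hx] at hy
    have h := hf x hx y hy
    rw [hU.nhdsWithin_eq hx] at h
    filter_upwards [h, hU.mem_nhds hx] with z hz hzU
    rwa [indicator_of_mem hzU]
  · simp [indicator_of_notMem hx] at hy

/-- Determinant of multiplication by a complex number. -/
theorem abs_det_restrictScalars_smulRight (c : ℂ) :
    |((ContinuousLinearMap.toSpanSingleton ℂ c).restrictScalars ℝ).det| = ‖c‖ ^ 2 := by
  simp [ContinuousLinearMap.det, LinearMap.det_restrictScalars,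
      Algebra.norm_complex_eq, Complex.normSq_eq_norm_sq]

namespace IsPositiveSuperharmonicOn

variable {w : ℂ → ℝ≥0∞}

theorem lowerSemicontinuous_indicator_comp (hw : IsPositiveSuperharmonicOn w unitDisk) {a : ℂ}
    (ha : ‖a‖ < 1) :
    LowerSemicontinuous (unitDisk.indicator fun z => w (diskInvolution a z)) := by
  refine LowerSemicontinuousOn.lowerSemicontinuous_indicator ?_ isOpen_unitDisk
  intro x hx y hy
  exact ((differentiableOn_diskInvolution ha).continuousOn x hx).tendsto_nhdsWithin
    (mapsTo_diskInvolution ha) (hw.lowerSemicontinuousOn _ (mapsTo_diskInvolution ha hx) y hy)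

/-- The super-mean value inequality on images of circles under disk involutions. -/
theorem circleMean_comp_diskInvolution_le (hw : IsPositiveSuperharmonicOn w unitDisk) {a : ℂ}
    (ha : ‖a‖ < 1) {r : ℝ} (hr : 0 < r) (hr1 : r < 1) :
    ∫⁻ θ in Ioc 0 (2 * Real.pi),
      unitDisk.indicator (fun z => w (diskInvolution a z)) (circleMap 0 r θ) ≤
        ENNReal.ofReal (2 * Real.pi) * w a := by
  have hball : closedBall (0 : ℂ) r ⊆ unitDisk := closedBall_subset_ball hr1
  have hφc : ContinuousOn (diskInvolution a) unitDisk :=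
    (differentiableOn_diskInvolution ha).continuousOn
  obtain ⟨g, hgc, hgm, hgn, hgs⟩ :=
    (hw.lowerSemicontinuous_indicator_comp ha).exists_monotone_continuous_iSup_eq
  simp_rw [← hgs]
  rw [lintegral_iSup (f := fun n θ => g n (circleMap 0 r θ))
    (fun n => ((hgc n).comp (continuous_circleMap 0 r)).measurable)
    fun m n hmn θ => hgm hmn _]
  refine iSup_le fun n => ?_
  have hfin : ∀ x, g n x ≠ ∞ := fun x => ((hgn n x).trans_lt (ENNReal.natCast_lt_top n)).ne
  set γ : ℂ → ℝ := fun x => (g n x).toReal with hγ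
  have hγc : Continuous γ := by
    rw [← continuousOn_univ]
    exact ENNReal.continuousOn_toReal.comp (hgc n).continuousOn fun x _ => hfin x
  refine ENNReal.le_of_forall_pos_le_add fun e he _ => ?_
  -- The error `ε` enters twice, each time integrated over length `2π`: in `γ ≤ Re G + ε`, and in
  -- the shift by `-ε` that puts the comparison function below `w` on the boundary.
  set ε : ℝ := e / (4 * Real.pi) with hε
  have hε0 : 0 < ε := by have : (0 : ℝ) < e := he; positivity
  obtain ⟨G, hG, hGγ⟩ := exists_differentiable_re_approx_on_sphere hγc hr hε0
  have hO : IsOpen (diskInvolution a '' ball 0 r) := by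
    have : diskInvolution a '' ball 0 r = unitDisk ∩ diskInvolution a ⁻¹' ball 0 r := by
      ext x
      constructor
      · rintro ⟨y, hy, rfl⟩
        have hyD := hball (ball_subset_closedBall hy)
        refine ⟨mapsTo_diskInvolution ha hyD, ?_⟩
        rwa [mem_preimage, diskInvolution_diskInvolution ha (mem_unitDisk.1 hyD)]
      · rintro ⟨hx, hx'⟩
        exact ⟨_, hx', diskInvolution_diskInvolution ha (mem_unitDisk.1 hx)⟩
    rw [this]
    exact hφc.isOpen_inter_preimage isOpen_unitDisk isOpen_ball
  have key := hw.re_le_of_boundary (K := diskInvolution a '' closedBall 0 r)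
    (O := diskInvolution a '' ball 0 r) (G := fun x => G (diskInvolution a x) - ε)
    ((isCompact_closedBall 0 r).image_of_continuousOn (hφc.mono hball))
    ((image_mono hball).trans (image_diskInvolution_unitDisk ha).subset) hO
    (image_mono ball_subset_closedBall)
    ((hG.comp_differentiableOn (differentiableOn_diskInvolution ha)).sub_const _) ?_
    a ⟨0, by simp [hr.le], by simp⟩
  · simp only [diskInvolution_self, Complex.sub_re, Complex.ofReal_re] at key
    have hπ := Real.two_pi_pos
    have hGc : Continuous fun θ => (G (circleMap 0 r θ)).re :=
      Complex.continuous_re.comp (hG.continuous.comp (continuous_circleMap 0 r))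
    have hInt : ∀ {f : ℝ → ℝ}, Continuous f → IntegrableOn f (Ioc 0 (2 * Real.pi)) := fun hf =>
      (hf.integrableOn_Icc).mono_set Ioc_subset_Icc_self
    calc ∫⁻ θ in Ioc 0 (2 * Real.pi), g n (circleMap 0 r θ)
        = ∫⁻ θ in Ioc 0 (2 * Real.pi), ENNReal.ofReal (γ (circleMap 0 r θ)) := by
          simp only [hγ, ENNReal.ofReal_toReal (hfin _)]
      _ = ENNReal.ofReal (∫ θ in Ioc 0 (2 * Real.pi), γ (circleMap 0 r θ)) :=
          (ofReal_integral_eq_lintegral_ofReal (hInt (hγc.comp (continuous_circleMap 0 r)))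
            (ae_of_all _ fun θ => ENNReal.toReal_nonneg)).symm
      _ ≤ ENNReal.ofReal (∫ θ in Ioc 0 (2 * Real.pi), ((G (circleMap 0 r θ)).re + ε)) := by
          refine ENNReal.ofReal_le_ofReal (integral_mono (hInt (hγc.comp (continuous_circleMap 0 r)))
            (hInt (hGc.add continuous_const)) fun θ => ?_)
          have := (abs_lt.1 (hGγ θ)).2
          dsimp only
          linarith
      _ = ENNReal.ofReal (2 * Real.pi * ((G 0).re - ε) + e) := by
          congr 1
          rw [integral_add (hInt hGc) (hInt continuous_const),
            integral_re_circleMap hr hG.differentiableOn]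
          simp [hε, hπ.le]
          field_simp
          ring
      _ ≤ ENNReal.ofReal (2 * Real.pi * ((G 0).re - ε)) + ENNReal.ofReal e :=
          ENNReal.ofReal_add_le
      _ ≤ ENNReal.ofReal (2 * Real.pi) * w a + e := by
          rw [ENNReal.ofReal_mul hπ.le, ENNReal.ofReal_coe_nnreal]
          gcongr
  · rintro _ ⟨⟨ζ, hζ, rfl⟩, hζO⟩
    have hζr : ‖ζ‖ = r := by
      refine le_antisymm (by simpa using hζ) (not_lt.1 fun h => hζO ⟨ζ, by simpa using h, rfl⟩)
    have hζD := hball hζ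
    obtain ⟨θ, rfl⟩ : ∃ θ, circleMap 0 r θ = ζ := by
      have : ζ ∈ range (circleMap 0 r) := by
        rw [range_circleMap]
        simp [hζr, abs_of_pos hr]
      exact this
    simp only [diskInvolution_diskInvolution ha (mem_unitDisk.1 hζD), Complex.sub_re,
      Complex.ofReal_re]
    calc ENNReal.ofReal ((G (circleMap 0 r θ)).re - ε) ≤ ENNReal.ofReal (γ (circleMap 0 r θ)) := by
          refine ENNReal.ofReal_le_ofReal ?_
          have := (abs_lt.1 (hGγ θ)).1
          linarith
      _ = g n (circleMap 0 r θ) := ENNReal.ofReal_toReal (hfin _)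
      _ ≤ ⨆ n, g n (circleMap 0 r θ) := le_iSup (fun n => g n (circleMap 0 r θ)) n
      _ = w (diskInvolution a (circleMap 0 r θ)) := by rw [hgs, indicator_of_mem hζD]

/-- In polar coordinates each circle of radius `r < 1` contributes at most `2π r w(a)`. -/
theorem setLIntegral_comp_diskInvolution_le (hw : IsPositiveSuperharmonicOn w unitDisk) {a : ℂ}
    (ha : ‖a‖ < 1) :
    ∫⁻ z in unitDisk, w (diskInvolution a z) ≤ ENNReal.ofReal Real.pi * w a := by
  set v := unitDisk.indicator fun z => w (diskInvolution a z) with hv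
  have hvm : Measurable v := (hw.lowerSemicontinuous_indicator_comp ha).measurable
  have hπ := Real.pi_pos
  have hsymm : ∀ p : ℝ × ℝ, Complex.polarCoord.symm p = circleMap 0 p.1 p.2 := fun p => by
    rw [Complex.polarCoord_symm_apply, circleMap_zero, Complex.exp_mul_I]
    push_cast
    rfl
  have hper : ∀ r : ℝ, ∫⁻ θ in Ioo (-Real.pi) Real.pi, v (circleMap 0 r θ) =
      ∫⁻ θ in Ioc 0 (2 * Real.pi), v (circleMap 0 r θ) := by
    intro r
    rw [setLIntegral_congr Ioo_ae_eq_Ioc]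
    have h := (isAddFundamentalDomain_Ioc Real.two_pi_pos (-Real.pi)).setLIntegral_eq
      (isAddFundamentalDomain_Ioc Real.two_pi_pos 0) (fun θ => v (circleMap 0 r θ)) ?_
    · rwa [zero_add, show -Real.pi + 2 * Real.pi = Real.pi by ring] at h
    · rintro ⟨_, k, rfl⟩ θ
      have := (periodic_circleMap 0 r).int_mul k θ
      simp only [AddSubgroup.vadd_def, vadd_eq_add, zsmul_eq_mul] at this ⊢
      rw [add_comm, this]
  rw [← lintegral_indicator isOpen_unitDisk.measurableSet, ← hv,
    ← Complex.lintegral_comp_polarCoord_symm]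
  simp only [hsymm, smul_eq_mul]
  have hm : Measurable fun p : ℝ × ℝ => ENNReal.ofReal p.1 * v (circleMap 0 p.1 p.2) := by
    refine (ENNReal.measurable_ofReal.comp measurable_fst).mul (hvm.comp ?_)
    unfold circleMap
    fun_prop
  have htarget : polarCoord.target = Ioi (0 : ℝ) ×ˢ Ioo (-Real.pi) Real.pi := rfl
  rw [htarget, Measure.volume_eq_prod, setLIntegral_prod _ hm.aemeasurable]
  calc ∫⁻ r in Ioi 0, ∫⁻ θ in Ioo (-Real.pi) Real.pi, ENNReal.ofReal r * v (circleMap 0 r θ)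
      ≤ ∫⁻ r in Ioi 0, (Ioo (0 : ℝ) 1).indicator
          (fun r => ENNReal.ofReal r * (ENNReal.ofReal (2 * Real.pi) * w a)) r := by
        refine setLIntegral_mono' measurableSet_Ioi fun r hr => ?_
        rw [lintegral_const_mul' _ _ ENNReal.ofReal_ne_top, hper]
        by_cases hr1 : r < 1
        · rw [indicator_of_mem (show r ∈ Ioo (0 : ℝ) 1 from ⟨hr, hr1⟩)]
          gcongr
          exact hw.circleMean_comp_diskInvolution_le ha hr hr1
        · have : ∀ θ, v (circleMap 0 r θ) = 0 := fun θ => by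
            refine indicator_of_notMem (fun h => hr1 ?_) _
            rw [mem_unitDisk] at h
            simpa [abs_of_pos (mem_Ioi.1 hr)] using h
          simp [this]
    _ ≤ ∫⁻ r in Ioo (0 : ℝ) 1, ENNReal.ofReal r * (ENNReal.ofReal (2 * Real.pi) * w a) := by
        rw [← lintegral_indicator measurableSet_Ioo]
        exact setLIntegral_le_lintegral _ _
    _ = ENNReal.ofReal Real.pi * w a := by
        rw [lintegral_mul_const _ ENNReal.measurable_ofReal,
          ← ofReal_integral_eq_lintegral_ofReal, ← integral_Ioc_eq_integral_Ioo,
          ← intervalIntegral.integral_of_le zero_le_one, integral_id, ← mul_assoc,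
          ← ENNReal.ofReal_mul (by norm_num)]
        · congr 2
          ring
        · exact (continuous_id.integrableOn_Icc).mono_set Ioo_subset_Icc_self
        · exact (ae_restrict_mem measurableSet_Ioo).mono fun r hr => hr.1.le

theorem setLIntegral_deriv_diskInvolution_le (hw : IsPositiveSuperharmonicOn w unitDisk) {a : ℂ}
    (ha : ‖a‖ < 1) :
    ∫⁻ z in unitDisk, ‖deriv (diskInvolution a) z‖ₑ ^ 2 * w z ≤
      ENNReal.ofReal Real.pi * w a := by
  refine le_trans (le_of_eq ?_) (hw.setLIntegral_comp_diskInvolution_le ha)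
  have h := lintegral_image_eq_lintegral_abs_det_fderiv_mul volume
    isOpen_unitDisk.measurableSet (f := diskInvolution a)
    (f' := fun z => (ContinuousLinearMap.toSpanSingleton ℂ
      (deriv (diskInvolution a) z)).restrictScalars ℝ)
    (fun z hz => (((differentiableOn_diskInvolution ha).differentiableAt
      (isOpen_unitDisk.mem_nhds hz)).hasDerivAt.hasFDerivAt.restrictScalars ℝ).hasFDerivWithinAt)
    (injOn_diskInvolution ha) (fun z => w (diskInvolution a z))
  rw [image_diskInvolution_unitDisk ha] at h
  rw [h]
  refine setLIntegral_congr_fun isOpen_unitDisk.measurableSet fun z hz => ?_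
  simp only [abs_det_restrictScalars_smulRight,
    diskInvolution_diskInvolution ha (mem_unitDisk.1 hz)]
  rw [ENNReal.ofReal_pow (norm_nonneg _), ofReal_norm]

end IsPositiveSuperharmonicOn

/-! ### Bumps and their estimates -/

/-- A holomorphic bump adapted to the point `a` of the disk: it is small on compact sets when `a`
is close to the unit circle, and of size `R` near `a`. -/
noncomputable def diskBump (R : ℝ) (a z : ℂ) : ℂ :=
  R * (diskInvolution a z * (diskInvolution a z - a))

section diskBump

variable {R : ℝ} {a z : ℂ}

theorem differentiableOn_diskBump (ha : ‖a‖ < 1) :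
    DifferentiableOn ℂ (diskBump R a) unitDisk :=
  ((differentiableOn_diskInvolution ha).mul
    ((differentiableOn_diskInvolution ha).sub_const a)).const_mul _

theorem diskBump_diskInvolution (ha : ‖a‖ < 1) (hz : ‖z‖ < 1) :
    diskBump R a (diskInvolution a z) = R * (z * (z - a)) := by
  rw [diskBump, diskInvolution_diskInvolution ha hz]

theorem norm_diskBump_le_two_mul (hR : 0 ≤ R) (ha : ‖a‖ < 1) (hz : ‖z‖ < 1) :
    ‖diskBump R a z‖ ≤ 2 * R := by
  have h1 := norm_diskInvolution_lt_one ha hz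
  have h2 : ‖diskInvolution a z - a‖ ≤ 2 := (norm_sub_le _ _).trans (by linarith)
  rw [diskBump, norm_mul, norm_mul, Complex.norm_real, Real.norm_of_nonneg hR, mul_comm 2]
  gcongr
  nlinarith [norm_nonneg (diskInvolution a z), norm_nonneg (diskInvolution a z - a)]

theorem norm_diskBump_le_div (hR : 0 ≤ R) (ha : ‖a‖ < 1) (hz : ‖z‖ < 1) :
    ‖diskBump R a z‖ ≤ R * (1 - ‖a‖ ^ 2) / (1 - ‖z‖) := by
  have h0 : 0 ≤ 1 - ‖a‖ ^ 2 := by nlinarith [norm_nonneg a]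
  have hz' : 0 < 1 - ‖z‖ := sub_pos.2 hz
  have h1 := norm_diskInvolution_lt_one ha hz
  have h2 : ‖diskInvolution a z - a‖ ≤ (1 - ‖a‖ ^ 2) / (1 - ‖z‖) := by
    rw [diskInvolution_sub ha hz, norm_div, norm_neg, norm_mul, Complex.norm_real,
      Real.norm_of_nonneg h0]
    gcongr
    · exact mul_le_of_le_one_left h0 hz.le
    · exact one_sub_norm_le_norm_one_sub_conj_mul ha.le
  rw [diskBump, norm_mul, norm_mul, Complex.norm_real, Real.norm_of_nonneg hR, mul_div_assoc]
  gcongr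
  exact (mul_le_of_le_one_left (norm_nonneg _) h1.le).trans h2

theorem norm_deriv_diskBump_le (hR : 0 ≤ R) (ha : ‖a‖ < 1) (hz : ‖z‖ < 1) :
    ‖deriv (diskBump R a) z‖ ≤ 3 * R * ‖deriv (diskInvolution a) z‖ := by
  have hd := ((differentiableOn_diskInvolution ha).differentiableAt
      (isOpen_unitDisk.mem_nhds (mem_unitDisk.2 hz))).hasDerivAt
  have h : deriv (diskBump R a) z =
      R * (2 * diskInvolution a z - a) * deriv (diskInvolution a) z := by
    have := ((hd.mul (hd.sub_const a)).const_mul (R : ℂ)).deriv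
    rw [show diskBump R a = fun z => (R : ℂ) * ((diskInvolution a * fun z =>
      diskInvolution a z - a) z) from rfl, this]
    ring
  have h1 := norm_diskInvolution_lt_one ha hz
  have h2 : ‖2 * diskInvolution a z - a‖ ≤ 3 := by
    refine (norm_sub_le _ _).trans ?_
    rw [norm_mul, Complex.norm_ofNat]
    linarith
  rw [h, norm_mul, norm_mul, Complex.norm_real, Real.norm_of_nonneg hR, mul_comm 3]
  gcongr

/-- The involution maps `‖z‖ ≤ 1/2` into a region no nearer the circle than a fixed multiple of `1 -
‖a‖²`; this lets bumps centered much closer to the circle be negligible there. -/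
theorem div_six_le_one_sub_norm_diskInvolution (ha : ‖a‖ < 1) (hz : ‖z‖ ≤ 1 / 2) :
    (1 - ‖a‖ ^ 2) / 6 ≤ 1 - ‖diskInvolution a z‖ := by
  have hz1 : ‖z‖ < 1 := by linarith
  have h1 := norm_diskInvolution_lt_one ha hz1
  have h0 : 0 ≤ 1 - ‖a‖ ^ 2 := by nlinarith [norm_nonneg a]
  have h2 : ‖1 - (starRingEnd ℂ) a * z‖ ≤ 3 / 2 := by
    refine (norm_sub_le _ _).trans ?_
    rw [norm_one, norm_mul, RCLike.norm_conj]
    nlinarith [norm_nonneg a, norm_nonneg z]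
  have h3 := one_sub_norm_diskInvolution_sq ha hz1
  have h4 : (1 - ‖a‖ ^ 2) / 3 ≤ 1 - ‖diskInvolution a z‖ ^ 2 := by
    rw [h3, le_div_iff₀ (by have := one_sub_conj_mul_ne_zero ha hz1; positivity)]
    have h5 : ‖1 - (starRingEnd ℂ) a * z‖ ^ 2 ≤ (3 / 2) ^ 2 := by gcongr
    have h6 : ‖z‖ ^ 2 ≤ (1 / 2) ^ 2 := by gcongr
    nlinarith
  nlinarith [norm_nonneg (diskInvolution a z)]

end diskBump

/-- Each `x k` is at most `2⁻ᵏ √T`, and the geometric series sums to `2`. The weights `4 ^ k`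
replace orthogonality when the energies of the bumps are added. -/
theorem ENNReal.sq_tsum_le (x : ℕ → ℝ≥0∞) : (∑' k, x k) ^ 2 ≤ 4 * ∑' k, 4 ^ k * x k ^ 2 := by
  set T := ∑' k, 4 ^ k * x k ^ 2 with hT
  have h1 : ∀ k, x k ≤ 2⁻¹ ^ k * T ^ (1 / 2 : ℝ) := fun k => by
    have h2 : (2 ^ k * x k) ^ 2 ≤ T := by
      refine le_trans (le_of_eq ?_) (ENNReal.le_tsum k)
      rw [mul_pow, ← pow_mul, mul_comm k, pow_mul]
      norm_num
    have h3 : 2 ^ k * x k ≤ T ^ (1 / 2 : ℝ) := by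
      rw [one_div, ENNReal.le_rpow_inv_iff (by norm_num)]
      exact_mod_cast h2
    calc x k = 2⁻¹ ^ k * (2 ^ k * x k) := by
          rw [← mul_assoc, ← mul_pow, ENNReal.inv_mul_cancel (by norm_num) (by norm_num)]
          simp
      _ ≤ _ := by gcongr
  calc (∑' k, x k) ^ 2 ≤ (∑' k, 2⁻¹ ^ k * T ^ (1 / 2 : ℝ)) ^ 2 := by gcongr with k; exact h1 k
    _ = 4 * T := by
      rw [ENNReal.tsum_mul_right, ENNReal.tsum_geometric, ENNReal.one_sub_inv_two, inv_inv,
        mul_pow, ← ENNReal.rpow_natCast (T ^ _), ← ENNReal.rpow_mul]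
      norm_num

theorem DifferentiableOn.mem_image_of_norm_sub_le {F : ℂ → ℂ} (hF : DifferentiableOn ℂ F unitDisk)
    {c : ℂ} {ε : ℝ} (hε : 0 < ε) (hF' : ∀ z ∈ sphere (0 : ℂ) (1 / 2), ε ≤ ‖F z - F 0‖)
    (hc : ‖c - F 0‖ < ε / 2) : c ∈ F '' unitDisk := by
  have hsub : closedBall (0 : ℂ) (1 / 2) ⊆ unitDisk := closedBall_subset_ball (by norm_num)
  have h := DiffContOnCl.ball_subset_image_closedBall (z₀ := (0 : ℂ)) (r := 1 / 2) (ε := ε)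
    (f := F) (hF.mono ((closure_ball (0 : ℂ) (by norm_num : (1 / 2 : ℝ) ≠ 0)).subset.trans
      hsub)).diffContOnCl (by norm_num) hF' ?_
  · exact image_mono hsub (h (by simpa [dist_eq_norm] using hc))
  -- By the identity theorem, local constancy at `0` would make `F` constant, against the lower
  -- bound at `1/2`.
  · intro hcon
    have hcon' : F =ᶠ[𝓝 0] fun _ => F 0 :=
      hcon.mono fun z hz => not_not.1 hz
    have hEq := (hF.analyticOnNhd isOpen_unitDisk).eqOn_of_preconnected_of_eventuallyEq
      analyticOnNhd_const (convex_ball (0 : ℂ) 1).isPreconnected (by simp [unitDisk]) hcon'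
    have hz : (1 / 2 : ℂ) ∈ sphere (0 : ℂ) (1 / 2) := by simp
    have h1 := hF' _ hz
    rw [hEq (hsub (sphere_subset_closedBall hz))] at h1
    simp at h1
    linarith

/-! ### Energy of a bump and choice of the centers -/

namespace IsPositiveSuperharmonicOn

variable {w : ℂ → ℝ≥0∞}

theorem setLIntegral_deriv_diskBump_le (hw : IsPositiveSuperharmonicOn w unitDisk) {a : ℂ} {R : ℝ}
    (hR : 0 ≤ R) (ha : ‖a‖ < 1) :
    ∫⁻ z in unitDisk, ‖deriv (diskBump R a) z‖ₑ ^ 2 * w z ≤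
      ENNReal.ofReal ((3 * R) ^ 2 * Real.pi) * w a := by
  calc ∫⁻ z in unitDisk, ‖deriv (diskBump R a) z‖ₑ ^ 2 * w z
      ≤ ∫⁻ z in unitDisk, ENNReal.ofReal (3 * R) ^ 2 *
          (‖deriv (diskInvolution a) z‖ₑ ^ 2 * w z) := by
        refine setLIntegral_mono' isOpen_unitDisk.measurableSet fun z hz => ?_
        rw [← mul_assoc, ← mul_pow]
        gcongr
        rw [← ofReal_norm, ← ofReal_norm, ← ENNReal.ofReal_mul (by positivity)]
        exact ENNReal.ofReal_le_ofReal (norm_deriv_diskBump_le hR ha (mem_unitDisk.1 hz))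
    _ = ENNReal.ofReal (3 * R) ^ 2 *
          ∫⁻ z in unitDisk, ‖deriv (diskInvolution a) z‖ₑ ^ 2 * w z :=
        lintegral_const_mul' _ _ (by finiteness)
    _ ≤ ENNReal.ofReal (3 * R) ^ 2 * (ENNReal.ofReal Real.pi * w a) := by
        gcongr
        exact hw.setLIntegral_deriv_diskInvolution_le ha
    _ = _ := by
        rw [← ENNReal.ofReal_pow (by positivity), ← mul_assoc,
          ← ENNReal.ofReal_mul (by positivity)]

/-- If `inf w = 0`, then small values of `w` occur arbitrarily close to the unit circle. -/
theorem exists_lt_near_boundary (hw : IsPositiveSuperharmonicOn w unitDisk)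
    (hinf : (⨅ z ∈ unitDisk, w z) = 0) {ε : ℝ≥0∞} (hε : 0 < ε) {η : ℝ} (hη : 0 < η) :
    ∃ a : ℂ, ‖a‖ < 1 ∧ w a < ε ∧ 1 - ‖a‖ ^ 2 ≤ η := by
  -- If `‖a‖ > s`, then `1 - ‖a‖² ≤ 2 (1 - ‖a‖) ≤ η`. The maximum with `0` keeps the closed ball
  -- nonempty when `η > 2`.
  set s : ℝ := max (1 - η / 2) 0 with hs
  have hs0 : 0 ≤ s := le_max_right _ _
  have hs1 : s < 1 := max_lt (by linarith) one_pos
  have hsub : closedBall (0 : ℂ) s ⊆ unitDisk := closedBall_subset_ball hs1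
  obtain ⟨x₀, hx₀, hmin⟩ := (hw.lowerSemicontinuousOn.mono hsub).exists_isMinOn
    ⟨0, by simpa using hs0⟩ (isCompact_closedBall (0 : ℂ) s)
  have hpos : 0 < min ε (w x₀) := lt_min hε (hw.pos x₀ (hsub hx₀))
  rw [← hinf] at hpos
  simp only [iInf_lt_iff] at hpos
  obtain ⟨a, ha, hwa⟩ := hpos
  refine ⟨a, mem_unitDisk.1 ha, hwa.trans_le (min_le_left _ _), ?_⟩
  have hsa : s < ‖a‖ := by
    by_contra! h
    exact absurd (hmin (by simpa using h : a ∈ closedBall (0 : ℂ) s))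
      (not_le.2 (hwa.trans_le (min_le_right _ _)))
  have h1 : 1 - η / 2 ≤ s := le_max_left _ _
  have h2 := mem_unitDisk.1 ha
  nlinarith [norm_nonneg a]

theorem exists_seq_near_boundary (hw : IsPositiveSuperharmonicOn w unitDisk)
    (hinf : (⨅ z ∈ unitDisk, w z) = 0) {ε : ℕ → ℝ≥0∞} (hε : ∀ n, 0 < ε n) {η : ℕ → ℝ}
    (hη : ∀ n, 0 < η n) (hη1 : ∀ n, η n ≤ 1) :
    ∃ a : ℕ → ℂ, (∀ n, ‖a n‖ < 1) ∧ (∀ n, w (a n) < ε n) ∧ (∀ n, 1 - ‖a n‖ ^ 2 ≤ η n) ∧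
      ∀ m n, m < n → 1 - ‖a n‖ ^ 2 ≤ η n * (1 - ‖a m‖ ^ 2) := by
  have hδ : ∀ b : {b : ℂ // ‖b‖ < 1}, 0 < 1 - ‖b.1‖ ^ 2 := fun b => by
    nlinarith [norm_nonneg b.1, b.2]
  have step : ∀ (n : ℕ) (b : {b : ℂ // ‖b‖ < 1}), ∃ c : {b : ℂ // ‖b‖ < 1}, w c < ε n ∧
      1 - ‖c.1‖ ^ 2 ≤ η n * (1 - ‖b.1‖ ^ 2) := fun n b => by
    obtain ⟨c, hc, h1, h2⟩ := hw.exists_lt_near_boundary hinf (hε n) (mul_pos (hη n) (hδ b))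
    exact ⟨⟨c, hc⟩, h1, h2⟩
  choose F hFw hFδ using step
  -- The origin serves as a fictitious predecessor of the first point, since there `1 - ‖b‖² = 1`.
  let x : ℕ → {b : ℂ // ‖b‖ < 1} := fun n =>
    Nat.rec (F 0 ⟨0, by simp⟩) (fun n b => F (n + 1) b) n
  have hanti : Antitone fun n => 1 - ‖(x n).1‖ ^ 2 := antitone_nat_of_succ_le fun n =>
    (hFδ (n + 1) (x n)).trans (mul_le_of_le_one_left (hδ _).le (hη1 _))
  have hlt : ∀ m n, m < n → 1 - ‖(x n).1‖ ^ 2 ≤ η n * (1 - ‖(x m).1‖ ^ 2) := by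
    intro m n hmn
    obtain ⟨n, rfl⟩ := Nat.exists_eq_succ_of_ne_zero hmn.ne_bot
    exact (hFδ (n + 1) (x n)).trans
      (mul_le_mul_of_nonneg_left (hanti (Nat.lt_succ_iff.1 hmn)) (hη _).le)
  refine ⟨fun n => (x n).1, fun n => (x n).2, fun n => ?_, fun n => ?_, hlt⟩
  · cases n with
    | zero => exact hFw _ _
    | succ n => exact hFw (n + 1) (x n)
  · cases n with
    | zero => exact (hFδ 0 ⟨0, by simp⟩).trans (by simp)
    | succ n =>
      refine (hFδ (n + 1) (x n)).trans (mul_le_of_le_one_right (hη _).le ?_)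
      nlinarith [norm_nonneg (x n).1]

end IsPositiveSuperharmonicOn

/-! ### Necessity, by area -/

/-- A function of finite unweighted Dirichlet integral has an image of finite area. -/
theorem volume_image_unitDisk_le {f : ℂ → ℂ} (hf : DifferentiableOn ℂ f unitDisk) :
    volume (f '' unitDisk) ≤ ∫⁻ z in unitDisk, ‖deriv f z‖ₑ ^ 2 := by
  refine (addHaar_image_le_lintegral_abs_det_fderiv volume isOpen_unitDisk.measurableSet
    (f' := fun z => (ContinuousLinearMap.toSpanSingleton ℂ (deriv f z)).restrictScalars ℝ)
    fun z hz => ((hf.differentiableAt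
      (isOpen_unitDisk.mem_nhds hz)).hasDerivAt.hasFDerivAt.restrictScalars
        ℝ).hasFDerivWithinAt).trans (le_of_eq ?_)
  refine lintegral_congr fun z => ?_
  rw [abs_det_restrictScalars_smulRight, ENNReal.ofReal_pow (norm_nonneg _), ofReal_norm]

theorem iInf_eq_zero_of_mem_dirichletSpace {w : ℂ → ℝ≥0∞} {f : ℂ → ℂ}
    (hf : f ∈ dirichletSpace w) (hsurj : f '' unitDisk = univ) : (⨅ z ∈ unitDisk, w z) = 0 := by
  by_contra hne
  obtain ⟨hd, hfin⟩ := hf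
  set c := ⨅ z ∈ unitDisk, w z with hc
  have h1 : c * ∫⁻ z in unitDisk, ‖deriv f z‖ₑ ^ 2 ≤ ∫⁻ z in unitDisk, ‖deriv f z‖ₑ ^ 2 * w z := by
    rw [← lintegral_const_mul'' ]
    · refine setLIntegral_mono' isOpen_unitDisk.measurableSet fun z hz => ?_
      rw [mul_comm]
      gcongr
      exact iInf₂_le z hz
    · exact ((measurable_deriv f).enorm.pow_const 2).aemeasurable
  have h2 : ∫⁻ z in unitDisk, ‖deriv f z‖ₑ ^ 2 = ∞ := by
    have := volume_image_unitDisk_le hd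
    rw [hsurj] at this
    simpa using this
  rw [h2, ENNReal.mul_top hne, top_le_iff] at h1
  rw [dirichletIntegral, h1, ENNReal.mul_top (by simp)] at hfin
  exact lt_irrefl _ hfin

/-! ### Construction of the surjective function -/

/-- Growth rate of the bumps used to build a surjective function. -/
noncomputable def bumpHeight (k : ℕ) : ℝ := 1000 ^ (k + 1)

theorem bumpHeight_pos (k : ℕ) : 0 < bumpHeight k := by unfold bumpHeight; positivity

theorem le_bumpHeight (k : ℕ) : 1000 * (k + 1 : ℝ) ≤ bumpHeight k := by
  unfold bumpHeight
  have := one_add_mul_le_pow (a := (999 : ℝ)) (by norm_num) k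
  rw [pow_succ, mul_comm]
  norm_num at this ⊢
  nlinarith [(Nat.cast_nonneg k : (0 : ℝ) ≤ k)]

theorem sum_bumpHeight_le (k : ℕ) : ∑ j ∈ Finset.range k, bumpHeight j ≤ bumpHeight k / 999 := by
  unfold bumpHeight
  induction k with
  | zero => norm_num
  | succ k ih =>
    rw [Finset.sum_range_succ, pow_succ _ (k + 1)]
    linarith

theorem norm_diskBump_bumpHeight_le {a : ℕ → ℂ} (ha : ∀ n, ‖a n‖ < 1)
    (hδ : ∀ n, bumpHeight n * (1 - ‖a n‖ ^ 2) ≤ 1 / 2 / 2 ^ n / 6)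
    {ρ : ℝ} (hρ : ρ < 1) (k : ℕ) {z : ℂ} (hz : z ∈ ball 0 ρ) :
    ‖diskBump (bumpHeight k) (a k) z‖ ≤ 1 / (1 - ρ) / 2 / 2 ^ k := by
  have hz' : ‖z‖ < ρ := by simpa using hz
  have h1 := norm_diskBump_le_div (bumpHeight_pos k).le (ha k) (hz'.trans hρ)
  have h0 : 0 ≤ bumpHeight k * (1 - ‖a k‖ ^ 2) :=
    mul_nonneg (bumpHeight_pos k).le (by nlinarith [norm_nonneg (a k), ha k])
  have hρ' : 0 < 1 - ρ := sub_pos.2 hρ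
  calc _ ≤ _ := h1
    _ ≤ (1 / 2 / 2 ^ k) / (1 - ρ) := by
      gcongr
      refine (hδ k).trans (div_le_self (by positivity) (by norm_num))
    _ = _ := by field_simp

theorem differentiableOn_tsum_diskBump {a : ℕ → ℂ} (ha : ∀ n, ‖a n‖ < 1)
    (hδ : ∀ n, bumpHeight n * (1 - ‖a n‖ ^ 2) ≤ 1 / 2 / 2 ^ n / 6) :
    DifferentiableOn ℂ (fun z => ∑' k, diskBump (bumpHeight k) (a k) z) unitDisk ∧
    ∀ z ∈ unitDisk, Summable (fun k => diskBump (bumpHeight k) (a k) z) ∧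
      HasSum (fun k => deriv (diskBump (bumpHeight k) (a k)) z)
        (deriv (fun z => ∑' k, diskBump (bumpHeight k) (a k) z) z) := by
  have key : ∀ z ∈ unitDisk, ∃ ρ < 1, z ∈ ball (0 : ℂ) ρ := fun z hz => by
    obtain ⟨ρ, h1, h2⟩ := exists_between (mem_unitDisk.1 hz)
    exact ⟨ρ, h2, by simpa using h1⟩
  have hd : ∀ ρ < 1, ∀ k, DifferentiableOn ℂ (diskBump (bumpHeight k) (a k)) (ball 0 ρ) :=
    fun ρ hρ k => (differentiableOn_diskBump (ha k)).mono (ball_subset_ball hρ.le)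
  refine ⟨fun z hz => ?_, fun z hz => ?_⟩ <;> obtain ⟨ρ, hρ, hzρ⟩ := key z hz <;>
    have hs := (hasSum_geometric_two' (1 / (1 - ρ))).summable
  · exact ((Complex.differentiableOn_tsum_of_summable_norm hs (hd ρ hρ) isOpen_ball fun k x hx =>
      norm_diskBump_bumpHeight_le ha hδ hρ k hx).differentiableAt
        (isOpen_ball.mem_nhds hzρ)).differentiableWithinAt
  · exact ⟨Summable.of_norm_bounded hs fun k => norm_diskBump_bumpHeight_le ha hδ hρ k hzρ,
      Complex.hasSum_deriv_of_summable_norm hs (hd ρ hρ) isOpen_ball (fun k x hx =>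
        norm_diskBump_bumpHeight_le ha hδ hρ k hx) hzρ⟩

/-- Near `a k`, the sum of the bumps is dominated by the `k`-th bump. -/
theorem norm_tsum_diskBump_sub_le {a : ℕ → ℂ} (ha : ∀ n, ‖a n‖ < 1)
    (hδ : ∀ n, bumpHeight n * (1 - ‖a n‖ ^ 2) ≤ 1 / 2 / 2 ^ n / 6)
    (hδ' : ∀ m n, m < n → bumpHeight n * (1 - ‖a n‖ ^ 2) ≤ 1 / 2 / 2 ^ n / 6 * (1 - ‖a m‖ ^ 2))
    (k : ℕ) {z : ℂ} (hz : ‖z‖ ≤ 1 / 2) :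
    ‖(∑' j, diskBump (bumpHeight j) (a j) (diskInvolution (a k) z)) -
        bumpHeight k * (z * (z - a k))‖ ≤ 2 * (bumpHeight k / 999) + 1 := by
  have hz1 : ‖z‖ < 1 := by linarith
  set x := diskInvolution (a k) z with hx
  have hx1 : ‖x‖ < 1 := norm_diskInvolution_lt_one (ha k) hz1
  have hsum := ((differentiableOn_tsum_diskBump ha hδ).2 x (mem_unitDisk.2 hx1)).1
  rw [hsum.tsum_eq_add_tsum_ite k, hx, diskBump_diskInvolution (ha k) hz1, ← hx,
    add_sub_cancel_left]
  -- Earlier bumps are bounded by twice their heights; later ones by a geometric series of sum `1`.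
  have hS : HasSum (fun j => (if j ∈ Finset.range k then 2 * bumpHeight j else 0) +
      (1 : ℝ) / 2 / 2 ^ j) (∑ j ∈ Finset.range k, 2 * bumpHeight j + 1) := by
    refine HasSum.add ?_ (hasSum_geometric_two' 1)
    convert hasSum_sum_of_ne_finset_zero (s := Finset.range k)
      (f := fun j => if j ∈ Finset.range k then 2 * bumpHeight j else 0) ?_ using 1
    · exact Finset.sum_congr rfl fun j hj => by simp only [if_pos hj]
    · intro j hj
      simp only [if_neg hj]
    · infer_instance
  refine (tsum_of_norm_bounded hS fun j => ?_).trans ?_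
  · have hpow : (0 : ℝ) ≤ 1 / 2 / 2 ^ j := by positivity
    rcases lt_trichotomy j k with h | h | h
    · rw [if_neg h.ne, if_pos (Finset.mem_range.2 h)]
      exact (norm_diskBump_le_two_mul (bumpHeight_pos j).le (ha j) hx1).trans
        (le_add_of_nonneg_right hpow)
    · rw [if_pos h, norm_zero]
      refine add_nonneg ?_ hpow
      have := bumpHeight_pos j
      split_ifs <;> positivity
    · rw [if_neg h.ne', if_neg (by simpa using h.le), zero_add]
      refine (norm_diskBump_le_div (bumpHeight_pos j).le (ha j) hx1).trans ?_
      rw [div_le_iff₀ (sub_pos.2 hx1)]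
      have h6 := div_six_le_one_sub_norm_diskInvolution (ha k) hz
      calc _ ≤ _ := hδ' k j h
        _ = 1 / 2 / 2 ^ j * ((1 - ‖a k‖ ^ 2) / 6) := by ring
        _ ≤ _ := by gcongr
  · rw [← Finset.mul_sum]
    gcongr
    exact sum_bumpHeight_le k

theorem image_tsum_diskBump_eq_univ {a : ℕ → ℂ} (ha : ∀ n, ‖a n‖ < 1)
    (hδ : ∀ n, bumpHeight n * (1 - ‖a n‖ ^ 2) ≤ 1 / 2 / 2 ^ n / 6)
    (hδ' : ∀ m n, m < n → bumpHeight n * (1 - ‖a n‖ ^ 2) ≤ 1 / 2 / 2 ^ n / 6 * (1 - ‖a m‖ ^ 2)) :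
    (fun z => ∑' k, diskBump (bumpHeight k) (a k) z) '' unitDisk = univ := by
  refine eq_univ_of_forall fun c => ?_
  obtain ⟨k, hk⟩ := exists_nat_ge ‖c‖
  set f := fun z => ∑' k, diskBump (bumpHeight k) (a k) z with hf
  set F : ℂ → ℂ := fun z => f (diskInvolution (a k) z) with hF
  have hFd : DifferentiableOn ℂ F unitDisk := (differentiableOn_tsum_diskBump ha hδ).1.comp
    (differentiableOn_diskInvolution (ha k)) (mapsTo_diskInvolution (ha k))
  have hclose : ∀ z : ℂ, ‖z‖ ≤ 1 / 2 →
      ‖F z - bumpHeight k * (z * (z - a k))‖ ≤ 2 * (bumpHeight k / 999) + 1 :=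
    fun z hz => norm_tsum_diskBump_sub_le ha hδ hδ' k hz
  have hF0 : ‖F 0‖ ≤ 2 * (bumpHeight k / 999) + 1 := by simpa using hclose 0 (by simp)
  have hR := le_bumpHeight k
  have hk0 : (0 : ℝ) ≤ k := Nat.cast_nonneg k
  -- This keeps `‖z - a k‖ ≥ 1/4` on `‖z‖ = 1/2`, whence the lower bound `bumpHeight k / 8` for the
  -- main term.
  have hak : 3 / 4 ≤ ‖a k‖ := by
    have h1 := hδ k
    have h2 : (1 : ℝ) / 2 / 2 ^ k / 6 ≤ 1 := by
      rw [div_div, div_div]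
      refine (div_le_one₀ (by positivity)).2 ?_
      nlinarith [one_le_pow₀ (one_le_two : (1 : ℝ) ≤ 2) (n := k)]
    have h3 : 0 ≤ 1 - ‖a k‖ ^ 2 := by nlinarith [norm_nonneg (a k), ha k]
    nlinarith [norm_nonneg (a k)]
  obtain ⟨z, hz, hzc⟩ : c ∈ F '' unitDisk := by
    refine hFd.mem_image_of_norm_sub_le
      -- The error bound is subtracted twice, for `F z` and for `F 0`. Half of the rest still
      -- exceeds `k + ‖F 0‖`, because the height is at least `1000 (k + 1)`.
      (ε := bumpHeight k / 8 - 2 * (2 * (bumpHeight k / 999) + 1)) (by linarith) (fun z hz => ?_) ?_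
    · have hz' : ‖z‖ = 1 / 2 := by simpa using hz
      have h1 := hclose z hz'.le
      have h2 : bumpHeight k / 8 ≤ ‖bumpHeight k * (z * (z - a k))‖ := by
        rw [norm_mul, norm_mul, Complex.norm_real, Real.norm_of_nonneg (bumpHeight_pos k).le, hz']
        have h3 : 1 / 4 ≤ ‖z - a k‖ := by
          have := norm_sub_norm_le (a k) z
          rw [norm_sub_rev] at this
          linarith
        nlinarith [bumpHeight_pos k]
      have h4 : ‖bumpHeight k * (z * (z - a k))‖ ≤
          ‖F z - F 0‖ + (‖F z - bumpHeight k * (z * (z - a k))‖ + ‖F 0‖) := by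
        calc _ = ‖(F z - F 0) - ((F z - bumpHeight k * (z * (z - a k))) - F 0)‖ := by
              congr 1; ring
          _ ≤ _ := (norm_sub_le _ _).trans (by gcongr; exact norm_sub_le _ _)
      linarith
    · have := norm_sub_le c (F 0)
      linarith
  exact ⟨_, mapsTo_diskInvolution (ha k) hz, hzc⟩

/-- If `inf w = 0`, then the weighted Dirichlet space contains a surjective function. -/
theorem IsPositiveSuperharmonicOn.exists_surjective {w : ℂ → ℝ≥0∞}
    (hw : IsPositiveSuperharmonicOn w unitDisk) (hinf : (⨅ z ∈ unitDisk, w z) = 0) :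
    ∃ f ∈ dirichletSpace w, f '' unitDisk = univ := by
  obtain ⟨a, ha, hwa, hη, hη'⟩ := hw.exists_seq_near_boundary hinf
    -- The factor `8 ^ k` absorbs the weight `4 ^ k` from `ENNReal.sq_tsum_le` and leaves `2⁻ᵏ`; the
    -- other factor is the energy constant of the bump.
    (ε := fun k => ENNReal.ofReal (1 / (8 ^ k * ((3 * bumpHeight k) ^ 2 * Real.pi))))
    (η := fun k => 1 / 2 / 2 ^ k / 6 / bumpHeight k)
    (fun k => ENNReal.ofReal_pos.2 (by have := bumpHeight_pos k; positivity))
    (fun k => by have := bumpHeight_pos k; positivity)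
    (fun k => by
      have h1 : (1 : ℝ) ≤ bumpHeight k := by
        have := le_bumpHeight k
        have : (0 : ℝ) ≤ k := Nat.cast_nonneg k
        linarith
      have h2 : (1 : ℝ) ≤ 2 ^ k := one_le_pow₀ one_le_two
      rw [div_div, div_div, div_div]
      refine (div_le_one₀ (by positivity)).2 ?_
      nlinarith)
  have hδ : ∀ n, bumpHeight n * (1 - ‖a n‖ ^ 2) ≤ 1 / 2 / 2 ^ n / 6 := fun n => by
    rw [mul_comm]
    exact (le_div_iff₀ (bumpHeight_pos n)).1 (hη n)
  have hδ' : ∀ m n, m < n →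
      bumpHeight n * (1 - ‖a n‖ ^ 2) ≤ 1 / 2 / 2 ^ n / 6 * (1 - ‖a m‖ ^ 2) := fun m n hmn => by
    have := hη' m n hmn
    rw [div_mul_eq_mul_div, le_div_iff₀ (bumpHeight_pos n)] at this
    rwa [mul_comm]
  obtain ⟨hfd, hfs⟩ := differentiableOn_tsum_diskBump ha hδ
  refine ⟨_, ⟨hfd, ?_⟩, image_tsum_diskBump_eq_univ ha hδ hδ'⟩
  refine ENNReal.mul_lt_top (ENNReal.inv_lt_top.2 (ENNReal.ofReal_pos.2 Real.pi_pos)) ?_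
  have hwm : AEMeasurable w (volume.restrict unitDisk) :=
    (aemeasurable_indicator_iff isOpen_unitDisk.measurableSet).1
      (hw.lowerSemicontinuousOn.lowerSemicontinuous_indicator
        isOpen_unitDisk).measurable.aemeasurable
  calc ∫⁻ z in unitDisk, ‖deriv (fun z => ∑' k, diskBump (bumpHeight k) (a k) z) z‖ₑ ^ 2 * w z
      ≤ ∫⁻ z in unitDisk, 4 * ∑' k, 4 ^ k *
          (‖deriv (diskBump (bumpHeight k) (a k)) z‖ₑ ^ 2 * w z) := by
        refine setLIntegral_mono' isOpen_unitDisk.measurableSet fun z hz => ?_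
        rw [← (hfs z hz).2.tsum_eq]
        simp_rw [← mul_assoc]
        rw [ENNReal.tsum_mul_right, ← mul_assoc]
        gcongr
        refine le_trans ?_ (ENNReal.sq_tsum_le _)
        gcongr
        exact enorm_tsum_le_tsum_enorm
    _ = 4 * ∑' k, 4 ^ k *
          ∫⁻ z in unitDisk, ‖deriv (diskBump (bumpHeight k) (a k)) z‖ₑ ^ 2 * w z := by
        rw [lintegral_const_mul' _ _ (by norm_num), lintegral_tsum]
        · simp_rw [lintegral_const_mul' _ _ (ENNReal.pow_ne_top (ENNReal.ofNat_ne_top (n := 4)))]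
        · exact fun k => (((measurable_deriv _).enorm.pow_const 2).aemeasurable.mul hwm).const_mul _
    _ ≤ 4 * ∑' k : ℕ, 2⁻¹ ^ k := by
        gcongr with k
        have hR := bumpHeight_pos k
        calc _ ≤ 4 ^ k * (ENNReal.ofReal ((3 * bumpHeight k) ^ 2 * Real.pi) *
              ENNReal.ofReal (1 / (8 ^ k * ((3 * bumpHeight k) ^ 2 * Real.pi)))) := by
              gcongr
              refine (hw.setLIntegral_deriv_diskBump_le hR.le (ha k)).trans ?_
              gcongr
              exact (hwa k).le
          _ = ENNReal.ofReal (2⁻¹ ^ k) := by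
              rw [← ENNReal.ofReal_mul (by positivity),
                show (4 : ℝ≥0∞) ^ k = ENNReal.ofReal (4 ^ k) by
                  rw [ENNReal.ofReal_pow (by norm_num)]; norm_num,
                ← ENNReal.ofReal_mul (by positivity)]
              congr 1
              rw [show (8 : ℝ) = 4 * 2 by norm_num, mul_pow 4 2 k, inv_pow]
              field_simp
          _ = 2⁻¹ ^ k := by
              rw [ENNReal.ofReal_pow (by norm_num), ENNReal.ofReal_inv_of_pos two_pos]
              norm_num
    _ < ∞ := by
        rw [ENNReal.tsum_geometric, ENNReal.one_sub_inv_two, inv_inv]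
        finiteness

theorem theorem4 (w : ℂ → ℝ≥0∞) (hw : IsPositiveSuperharmonicOn w unitDisk) :
    (∃ f ∈ dirichletSpace w, f '' unitDisk = Set.univ) ↔ (⨅ z ∈ unitDisk, w z) = 0 := by
  exact ⟨fun ⟨_, hf, hsurj⟩ => iInf_eq_zero_of_mem_dirichletSpace hf hsurj, hw.exists_surjective⟩
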